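/- Let $V=\bigoplus_{n=0}^{\infty}V_n$ be a vertex operator algebra over $\mathbb{C}$, with vacuum $\mathbf 1\in V_0$, conformal vector $\omega\in V_2$ and vertex operators $Y(a,z)=\sum_{n\in\mathbb Z}a_nz^{-n-1}$. Let $C_2(V)=\mathrm{span}\{a_{-2}b : a,b\in V\}$; Zhu's $C_2$-algebra is the commutative associative algebra $V/C_2(V)$ with product $(a+C_2(V))(b+C_2(V))=a_{-1}b+C_2(V)$ and unit $\mathbf 1+C_2(V)$. Let $$O(V)=\mathrm{span}\Big\{\sum_{j\ge 0}\binom{n}{j}a_{j-2}b : n\ge 0,\ a\in V_n,\ b\in V\Big\};$$ Zhu's algebra is the associative algebra $A(V)=V/O(V)$ with unit $\mathbf 1+O(V)$ and product induced by $a\ast b=\sum_{j\ge 0}\binom{n}{j}a_{j-1}b$ for $a\in V_n$, $b\in V$ (extended linearly in $a$). Let $A(V)_n$ be the image of $\bigoplus_{i=0}^{n}V_i$ in $A(V)$ and $A(V)_{-1}=0$. This is an algebra filtration; let $\mathrm{gr}\,A(V)=\bigoplus_{n\ge 0}A(V)_n/A(V)_{n-1}$ be the associated graded algebra, with product $\bar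 x\ast\bar y=\overline{x\ast y}$. For $x\in V_n$ let $\bar x\in A(V)_n/A(V)_{n-1}$ denote the class of $x+O(V)$. Then $\mathrm{gr}\,A(V)$ is commutative, with $\bar a\ast\bar b=\overline{a_{-1}b}\in A(V)_{m+n}/A(V)_{m+n-1}$ for all $a\in V_m$, $b\in V_n$, and there is a well-defined surjective homomorphism of commutative $\mathbb{C}$-algebras $$\phi: V/C_2(V)\to \mathrm{gr}\,A(V),\qquad \phi(x+C_2(V))=\bar x\in A(V)_n/A(V)_{n-1}\quad\text{for } x\in V_n,\ n\ge 0.$$ -/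

import Mathlib

/-- For `Y(a, z) = ∑ a_n z ^ (-n - 1)`, the map `(a, b) ↦ a_n b`. -/
noncomputable def fieldMode {V : Type*} [AddCommGroup V] [Module ℂ V]
    (Y : V →ₗ[ℂ] VertexOperator ℂ V) (n : ℤ) : V →ₗ[ℂ] V →ₗ[ℂ] V :=
  LinearMap.proj n ∘ₗ VertexOperator.ncoeff ∘ₗ Y

/-- A vertex operator algebra `V = ⨁_{n ≥ 0} V_n` over `ℂ`.  The coefficient of `z ^ (-n - 1)` in
`Y(a, z) b`, i.e. the `n`-th mode `a_n b`, is `fieldMode Y n a b`; that `a_n b = 0` for `n` large is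
part of the type `VertexOperator ℂ V`.  Hence the sums `∑ᶠ` below have finite support. -/
class VertexOperatorAlgebra (V : Type*) [AddCommGroup V] [Module ℂ V] where
  /-- The state-field correspondence `a ↦ Y(a, z)`. -/
  Y : V →ₗ[ℂ] VertexOperator ℂ V
  /-- The vacuum vector. -/
  vac : V
  /-- The conformal vector. -/
  conf : V
  /-- The central charge. -/
  centralCharge : ℂ
  /-- The homogeneous subspaces `V_n`. -/
  wtSpace : ℕ → Submodule ℂ V
  isInternal_wtSpace : DirectSum.IsInternal wtSpace
  finiteDimensional_wtSpace : ∀ n, FiniteDimensional ℂ (wtSpace n)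
  vac_mem : vac ∈ wtSpace 0
  conf_mem : conf ∈ wtSpace 2
  /-- `Y(𝟏, z) = id`. -/
  vacuum : ∀ (n : ℤ) (b : V), fieldMode Y n vac b = if n = -1 then b else 0
  /-- `Y(a, z) 𝟏 ∈ a + z V[[z]]`. -/
  creation : ∀ a : V, fieldMode Y (-1) a vac = a
  creation_nonneg : ∀ (a : V) (n : ℕ), fieldMode Y (n : ℤ) a vac = 0
  /-- The Jacobi identity, in component form (the Borcherds identity). -/
  borcherds : ∀ (a b c : V) (l m n : ℤ),
    ∑ᶠ j : ℕ, Ring.choose m j • fieldMode Y (m + n - j) (fieldMode Y (l + j) a b) c =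
      ∑ᶠ j : ℕ, ((-1) ^ j * Ring.choose l j) •
        (fieldMode Y (m + l - j) a (fieldMode Y (n + j) b c) -
          l.negOnePow • fieldMode Y (n + l - j) b (fieldMode Y (m + j) a c))
  /-- The Virasoro relations for `L(n) = ω_{n+1}`. -/
  virasoro : ∀ (m n : ℤ) (b : V),
    fieldMode Y (m + 1) conf (fieldMode Y (n + 1) conf b) -
        fieldMode Y (n + 1) conf (fieldMode Y (m + 1) conf b) =
      (m - n) • fieldMode Y (m + n + 1) conf b +
        if m + n = 0 then (((m : ℂ) ^ 3 - m) / 12 * centralCharge) • b else 0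
  /-- `V_n` is the space of vectors of `L(0)`-weight `n`. -/
  L_zero : ∀ (n : ℕ), ∀ b ∈ wtSpace n, fieldMode Y 1 conf b = (n : ℂ) • b
  /-- `Y(L(-1) a, z) = d/dz Y(a, z)`. -/
  L_neg_one : ∀ (a b : V) (n : ℤ),
    fieldMode Y n (fieldMode Y 0 conf a) b = (-n) • fieldMode Y (n - 1) a b

namespace VertexOperatorAlgebra

open scoped DirectSum

variable {V : Type*} [AddCommGroup V] [Module ℂ V] [VertexOperatorAlgebra V]

/-- The product `a_n b`, as a bilinear map of `a` and `b`. -/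
noncomputable def mode (n : ℤ) : V →ₗ[ℂ] V →ₗ[ℂ] V := fieldMode Y n

theorem mode_apply (n : ℤ) (a b : V) : mode n a b = fieldMode Y n a b := rfl

theorem exists_mode_eq_zero (a b : V) : ∃ N : ℕ, ∀ n : ℤ, (N : ℤ) ≤ n → mode n a b = 0 := by
  refine ⟨(-(HahnSeries.order ((HahnModule.of ℂ).symm (Y a b)))).toNat, fun n hn => ?_⟩
  apply VertexOperator.ncoeff_eq_zero_of_lt_order
  omega

theorem borcherds_range (a b c : V) (l m n : ℤ) (N : ℕ)
    (h1 : ∀ j : ℕ, N ≤ j → mode (l + j) a b = 0)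
    (h2 : ∀ j : ℕ, N ≤ j → mode (n + j) b c = 0)
    (h3 : ∀ j : ℕ, N ≤ j → mode (m + j) a c = 0) :
    ∑ j ∈ Finset.range N, (Ring.choose m j) • mode (m + n - j) (mode (l + j) a b) c =
      ∑ j ∈ Finset.range N, ((-1) ^ j * Ring.choose l j) •
        (mode (m + l - j) a (mode (n + j) b c) -
          l.negOnePow • mode (n + l - j) b (mode (m + j) a c)) := by
  have h := borcherds a b c l m n
  simp only [← mode_apply] at h
  rw [finsum_eq_sum_of_support_subset (s := Finset.range N),
    finsum_eq_sum_of_support_subset (s := Finset.range N)] at h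
  · exact h
  · intro j hj
    by_contra hN
    simp only [Finset.coe_range, Set.mem_Iio, not_lt] at hN
    simp [h2 j hN, h3 j hN] at hj
  · intro j hj
    by_contra hN
    simp only [Finset.coe_range, Set.mem_Iio, not_lt] at hN
    simp [h1 j hN] at hj

theorem exists_bound (a b c : V) (l m n : ℤ) : ∃ N : ℕ,
    (∀ j : ℕ, N ≤ j → mode (l + j) a b = 0) ∧ (∀ j : ℕ, N ≤ j → mode (n + j) b c = 0) ∧
    (∀ j : ℕ, N ≤ j → mode (m + j) a c = 0) := by
  obtain ⟨N1, h1⟩ := exists_mode_eq_zero a b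
  obtain ⟨N2, h2⟩ := exists_mode_eq_zero b c
  obtain ⟨N3, h3⟩ := exists_mode_eq_zero a c
  refine ⟨N1 + N2 + N3 + l.natAbs + m.natAbs + n.natAbs, ?_, ?_, ?_⟩ <;> intro j hj
  · exact h1 _ (by omega)
  · exact h2 _ (by omega)
  · exact h3 _ (by omega)

theorem mode_vac_left (n : ℤ) (b : V) : mode n vac b = if n = -1 then b else 0 := vacuum n b

theorem mode_vac_right (a : V) : mode (-1) a vac = a := creation a

theorem mode_vac_right_nonneg (a : V) {n : ℤ} (hn : 0 ≤ n) : mode n a vac = 0 := by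
  lift n to ℕ using hn
  exact creation_nonneg a n

/-! ### Homogeneous components -/

theorem mode_zero_conf (a b : V) (n : ℤ) :
    mode n (mode 0 conf a) b = (-n) • mode (n - 1) a b := L_neg_one a b n

theorem mode_one_conf {n : ℕ} {b : V} (hb : b ∈ wtSpace n) : mode 1 conf b = (n : ℂ) • b :=
  L_zero n b hb

theorem decompose_L_zero (x : ⨁ n, wtSpace (V := V) n) :
    ∃ y : ⨁ n, wtSpace (V := V) n, mode 1 conf (DirectSum.coeLinearMap wtSpace x) =
      DirectSum.coeLinearMap wtSpace y ∧ ∀ n, y n = (n : ℂ) • x n := by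
  induction x using DirectSum.induction_on with
  | zero => exact ⟨0, by simp, by simp⟩
  | of i x =>
    refine ⟨(i : ℂ) • DirectSum.of (fun n => wtSpace (V := V) n) i x, ?_, ?_⟩
    · rw [map_smul, DirectSum.coeLinearMap_of, mode_one_conf x.2]
    · intro n
      rw [DirectSum.smul_apply]
      by_cases h : i = n
      · subst h; rfl
      · rw [DirectSum.of_eq_of_ne _ _ _ (Ne.symm h)]; simp
  | add x x' hx hx' =>
    obtain ⟨y, hy, hy'⟩ := hx
    obtain ⟨z, hz, hz'⟩ := hx'
    refine ⟨y + z, by rw [map_add, map_add, map_add, hy, hz], fun n => ?_⟩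
    rw [DirectSum.add_apply, DirectSum.add_apply, hy', hz', smul_add]

theorem mem_wtSpace_of_eigen {k : ℤ} {v : V} (hv : mode 1 conf v = (k : ℂ) • v) :
    (∀ n : ℕ, (n : ℤ) = k → v ∈ wtSpace n) ∧ (k < 0 → v = 0) := by
  obtain ⟨x, rfl⟩ := (isInternal_wtSpace (V := V)).2 v
  obtain ⟨y, hy, hy'⟩ := decompose_L_zero x
  change mode 1 conf (DirectSum.coeLinearMap wtSpace x) = _ • DirectSum.coeLinearMap wtSpace x at hv
  rw [hy, ← map_smul] at hv
  have hxy := (isInternal_wtSpace (V := V)).1 hv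
  have key : ∀ n : ℕ, (n : ℤ) ≠ k → x n = 0 := by
    intro n hn
    have := DFunLike.congr_fun hxy n
    rw [hy', DirectSum.smul_apply] at this
    have h2 : ((n : ℂ) - k) • x n = 0 := by rw [sub_smul, this, sub_self]
    refine (smul_eq_zero.1 h2).resolve_left fun h3 => hn ?_
    have : ((n : ℤ) : ℂ) = (k : ℂ) := by
      rw [Int.cast_natCast]; exact sub_eq_zero.1 h3
    exact_mod_cast this
  constructor
  · intro n hn
    have : x = DirectSum.of (fun n => wtSpace (V := V) n) n (x n) := by
      refine DFinsupp.ext fun i => ?_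
      by_cases h : i = n
      · subst h; rw [DirectSum.of_eq_same]
      · rw [DirectSum.of_eq_of_ne _ _ _ h, key i (by omega)]
    rw [this]
    rw [DirectSum.coeAddMonoidHom_of]
    exact (x n).2
  · intro hk
    have : x = 0 := DFinsupp.ext fun i => key i (by omega)
    rw [this, map_zero]

theorem L_zero_mode {p q : ℕ} {a b : V} (ha : a ∈ wtSpace p) (hb : b ∈ wtSpace q) (n : ℤ) :
    mode 1 conf (mode n a b) = ((p + q - n - 1 : ℤ) : ℂ) • mode n a b := by
  obtain ⟨N, h1, h2, h3⟩ := exists_bound (conf : V) a b 0 1 n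
  have h := borcherds_range (conf : V) a b 0 1 n (N + 2) (fun j hj => h1 j (by omega))
    (fun j hj => h2 j (by omega)) (fun j hj => h3 j (by omega))
  rw [Finset.sum_range_succ', Finset.sum_range_succ', Finset.sum_range_succ',
    Finset.sum_eq_zero, Finset.sum_eq_zero] at h
  · simp only [Ring.choose_zero_right, Ring.choose_one_right, zero_add, Nat.cast_zero,
      Nat.cast_one, pow_zero, Int.negOnePow_zero, add_zero, sub_zero, one_smul, mul_one] at h
    rw [mode_one_conf ha, mode_one_conf hb, mode_zero_conf] at h
    have e : (1 : ℤ) + n - 1 = n := by ring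
    have e' : (1 : ℤ) + n = n + 1 := by ring
    rw [e, e'] at h
    simp only [map_smul, LinearMap.smul_apply] at h
    rw [eq_comm, sub_eq_iff_eq_add] at h
    rw [h, ← Int.cast_smul_eq_zsmul ℂ]
    push_cast
    module
  · intro j _
    have : Ring.choose (0 : ℤ) (j + 1) = 0 := Ring.choose_zero_pos ℤ (by omega)
    simp [this]
  · intro j _
    have : Ring.choose (1 : ℤ) (j + 1 + 1) = 0 := by
      rw [show (1 : ℤ) = ((1 : ℕ) : ℤ) by rfl, Ring.choose_natCast]
      simp [Nat.choose_eq_zero_of_lt]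
    simp [this]

theorem mode_mem {p q k : ℕ} {a b : V} (ha : a ∈ wtSpace p) (hb : b ∈ wtSpace q) {n : ℤ}
    (hk : (k : ℤ) = p + q - n - 1) : mode n a b ∈ wtSpace k :=
  (mem_wtSpace_of_eigen (L_zero_mode ha hb n)).1 k hk

theorem mode_neg_one_mem {p q : ℕ} {a b : V} (ha : a ∈ wtSpace p) (hb : b ∈ wtSpace q) :
    mode (-1) a b ∈ wtSpace (p + q) := mode_mem ha hb (by push_cast; ring)

theorem mode_eq_zero {p q : ℕ} {a b : V} (ha : a ∈ wtSpace p) (hb : b ∈ wtSpace q) {n : ℤ}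
    (hn : (p : ℤ) + q - n - 1 < 0) : mode n a b = 0 :=
  (mem_wtSpace_of_eigen (L_zero_mode ha hb n)).2 hn

theorem wtSpace_induction {P : V → Prop} (a : V) (hom : ∀ n, ∀ a ∈ wtSpace n, P a)
    (zero : P 0) (add : ∀ a b, P a → P b → P (a + b)) : P a := by
  obtain ⟨x, rfl⟩ := (isInternal_wtSpace (V := V)).2 a
  induction x using DirectSum.induction_on with
  | zero => rw [map_zero]; exact zero
  | of i x =>
    rw [DirectSum.coeAddMonoidHom_of]; exact hom i x x.2
  | add x y hx hy => rw [map_add]; exact add _ _ hx hy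

/-! ### Residues

`res m f a b` is the residue of `Y(a, z) b f(z) z ^ (-m)` for a polynomial `f`. -/

open Polynomial in
noncomputable def res (m : ℤ) : ℂ[X] →ₗ[ℂ] V →ₗ[ℂ] V →ₗ[ℂ] V :=
  Polynomial.lsum fun i => LinearMap.toSpanSingleton ℂ (V →ₗ[ℂ] V →ₗ[ℂ] V) (mode (i - m))

open Polynomial in
theorem res_monomial (m : ℤ) (i : ℕ) (r : ℂ) (a b : V) :
    res m (monomial i r) a b = r • mode (i - m) a b := by
  simp [res, Polynomial.lsum_apply]

open Polynomial in
theorem res_X_mul (m : ℤ) (f : ℂ[X]) (a b : V) : res m (X * f) a b = res (m - 1) f a b := by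
  induction f using Polynomial.induction_on' with
  | add f g hf hg => simp only [mul_add, map_add, LinearMap.add_apply, hf, hg]
  | monomial i r =>
    rw [X_mul_monomial, res_monomial, res_monomial,
      show ((i + 1 : ℕ) : ℤ) - m = i - (m - 1) by push_cast; ring]

open Polynomial in
theorem res_one_add_X_mul (m : ℤ) (f : ℂ[X]) (a b : V) :
    res m ((1 + X) * f) a b = res m f a b + res (m - 1) f a b := by
  rw [add_mul, one_mul, map_add, LinearMap.add_apply, LinearMap.add_apply, res_X_mul]

open Polynomial in
theorem res_conf (m : ℤ) (f : ℂ[X]) (a b : V) :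
    res m f (mode 0 conf a) b =
      (m : ℂ) • res (m + 1) f a b - res m (derivative f) a b := by
  induction f using Polynomial.induction_on' with
  | add f g hf hg =>
    simp only [map_add, LinearMap.add_apply, hf, hg]; module
  | monomial i r =>
    rw [derivative_monomial, res_monomial, res_monomial, res_monomial, mode_zero_conf,
      ← Int.cast_smul_eq_zsmul ℂ]
    rcases i with _ | i
    · simp only [Nat.cast_zero, mul_zero, zero_smul, sub_zero, smul_smul]
      rw [show (0 : ℤ) - m - 1 = 0 - (m + 1) by ring]
      push_cast; congr 1; ring
    · rw [show ((i + 1 : ℕ) : ℤ) - m - 1 = i - m by push_cast; ring,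
        show ((i + 1 : ℕ) : ℤ) - (m + 1) = i - m by push_cast; ring, Nat.add_sub_cancel]
      push_cast; module

open Polynomial in
theorem res_natCast_pow (m : ℤ) (p : ℕ) (a b : V) :
    res m ((1 + X) ^ p) a b =
      ∑ j ∈ Finset.range (p + 1), (p.choose j : ℂ) • mode (j - m) a b := by
  have : ((1 + X) ^ p : ℂ[X]) = ∑ j ∈ Finset.range (p + 1), monomial j (p.choose j : ℂ) := by
    rw [add_comm, add_pow]
    refine Finset.sum_congr rfl fun j _ => ?_
    rw [one_pow, mul_one, ← C_mul_X_pow_eq_monomial, mul_comm]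
    simp
  rw [this, map_sum, LinearMap.sum_apply, LinearMap.sum_apply]
  exact Finset.sum_congr rfl fun j _ => res_monomial _ _ _ _ _

open Polynomial in
theorem hasseDeriv_one_add_X_pow (k p : ℕ) :
    hasseDeriv k ((1 + X) ^ p : ℂ[X]) = (p.choose k : ℂ) • (1 + X) ^ (p - k) := by
  have h := congrArg (fun F => F ((1 + X) ^ p : ℂ[X])) (factorial_smul_hasseDeriv (R := ℂ) (k := k))
  simp only [LinearMap.smul_apply] at h
  have h' : (⇑derivative)^[k] ((1 + X) ^ p : ℂ[X]) = (p.descFactorial k : ℂ) • (1 + X) ^ (p - k) := by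
    rw [add_comm, ← C_1, iterate_derivative_X_add_pow, nsmul_eq_mul, smul_eq_C_mul]
    simp
  have hk : ((k.factorial : ℕ) : ℂ) ≠ 0 := by exact_mod_cast k.factorial_ne_zero
  have h2 : (k.factorial : ℂ) • hasseDeriv k ((1 + X) ^ p : ℂ[X]) =
      (k.factorial : ℂ) • ((p.choose k : ℂ) • (1 + X) ^ (p - k) : ℂ[X]) := by
    rw [smul_smul, ← Nat.cast_mul, ← Nat.descFactorial_eq_factorial_mul_choose, ← h',
      Nat.cast_smul_eq_nsmul]
    exact h
  exact smul_right_injective _ hk h2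

open Polynomial in
/-- The Jacobi identity, paired with `f(z) g(w) (z - w) ^ l z ^ m w ^ n`. -/
theorem borcherds_res (a b c : V) (l m n : ℤ) (N : ℕ)
    (h1 : ∀ j : ℕ, N ≤ j → mode (l + j) a b = 0)
    (h2 : ∀ j : ℕ, N ≤ j → mode (n + j) b c = 0)
    (h3 : ∀ j : ℕ, N ≤ j → mode (m + j) a c = 0) (f g : ℂ[X]) :
    ∑ k ∈ Finset.range N, ∑ rs ∈ Finset.HasAntidiagonal.antidiagonal k,
        ((Ring.choose m rs.2 : ℤ) : ℂ) •
          res (rs.2 - m - n) (hasseDeriv rs.1 f * g) (mode (l + k) a b) c =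
      ∑ k ∈ Finset.range N, (((-1) ^ k * Ring.choose l k : ℤ) : ℂ) •
        (res (k - l - m) f a (res (-n - k) g b c) -
          l.negOnePow • res (k - n - l) g b (res (-m - k) f a c)) := by
  induction f using Polynomial.induction_on' with
  | add f f' hf hf' =>
    simp only [map_add, LinearMap.add_apply, add_mul, smul_add, Finset.sum_add_distrib, smul_sub,
      Finset.sum_sub_distrib] at hf hf' ⊢
    rw [hf, hf']; abel
  | monomial i r =>
  induction g using Polynomial.induction_on' with
  | add f f' hf hf' =>
    simp only [map_add, LinearMap.add_apply, mul_add, smul_add, Finset.sum_add_distrib, smul_sub,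
      Finset.sum_sub_distrib] at hf hf' ⊢
    rw [hf, hf']; abel
  | monomial s t =>
  have h := congrArg (fun v => (r * t) • v) <| borcherds_range a b c l (m + i) (n + s) N h1
    (fun j hj => by have := h2 (j + s) (by omega); rw [← this]; congr 2; push_cast; ring_nf)
    (fun j hj => by have := h3 (j + i) (by omega); rw [← this]; congr 2; push_cast; ring_nf)
  simp only [Finset.smul_sum] at h
  convert h using 1
  · refine Finset.sum_congr rfl fun k _ => ?_
    rw [add_comm m, Ring.add_choose_eq k (Commute.all _ _), Finset.sum_smul, Finset.smul_sum]
    refine Finset.sum_congr rfl fun rs hrs => ?_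
    rw [Finset.HasAntidiagonal.mem_antidiagonal] at hrs
    rw [hasseDeriv_monomial, monomial_mul_monomial, res_monomial, Ring.choose_natCast]
    by_cases hi : rs.1 ≤ i
    · rw [← Int.cast_smul_eq_zsmul ℂ, smul_smul, smul_smul]
      congr 1
      · push_cast; ring
      · congr 2; push_cast [Nat.cast_sub hi, ← hrs]; ring_nf
    · rw [Nat.choose_eq_zero_of_lt (by omega)]; simp
  · refine Finset.sum_congr rfl fun k _ => ?_
    simp only [res_monomial, map_smul]
    rw [← Int.cast_smul_eq_zsmul ℂ]
    simp only [Units.smul_def, ← Int.cast_smul_eq_zsmul ℂ]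
    rw [show (i : ℤ) - (k - l - m) = m + i + l - k by ring,
      show (s : ℤ) - (-n - k) = n + s + k by ring,
      show (s : ℤ) - (k - n - l) = n + s + l - k by ring,
      show (i : ℤ) - (-m - k) = m + i + k by ring]
    module

/-! ### Quotients by two-sided ideals -/

/-- The bilinear product on `M ⧸ N` induced by a bilinear product `μ` on `M` for which the
subspace `N` is a two-sided ideal. -/
noncomputable def quotMul {M : Type*} [AddCommGroup M] [Module ℂ M] (N : Submodule ℂ M)
    (μ : M →ₗ[ℂ] M →ₗ[ℂ] M) (hl : ∀ a, ∀ x ∈ N, μ a x ∈ N) (hr : ∀ x ∈ N, ∀ b, μ x b ∈ N) :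
    M ⧸ N →ₗ[ℂ] M ⧸ N →ₗ[ℂ] M ⧸ N :=
  N.liftQ
    { toFun := fun a => N.mapQ N (μ a) (hl a)
      map_add' := fun a b => by ext; simp
      map_smul' := fun r a => by ext; simp }
    (fun x hx => by
      rw [LinearMap.mem_ker]
      ext b
      exact (Submodule.Quotient.mk_eq_zero N).2 (hr x hx b))

/-! ### The `C₂`-algebra -/

section C2

variable (V) in
/-- `C₂(V)`, the span of all `a_{-2} b`. -/
def C2 : Submodule ℂ V := Submodule.span ℂ {x | ∃ a b : V, x = mode (-2) a b}

theorem mode_mem_C2 (n : ℕ) (a b : V) : mode (-2 - n) a b ∈ C2 V := by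
  induction n generalizing a with
  | zero => exact Submodule.subset_span ⟨a, b, by simp⟩
  | succ n ih =>
    have h := ih (mode 0 conf a)
    rw [mode_zero_conf, ← Int.cast_smul_eq_zsmul ℂ] at h
    have hn : ((-(-2 - (n : ℤ)) : ℤ) : ℂ) ≠ 0 := by
      rw [Int.cast_ne_zero]; omega
    rw [Submodule.smul_mem_iff _ hn] at h
    rwa [show -2 - (n : ℤ) - 1 = -2 - ((n + 1 : ℕ) : ℤ) by push_cast; ring] at h

theorem mode_mem_C2' {n : ℤ} (hn : n ≤ -2) (a b : V) : mode n a b ∈ C2 V := by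
  have := mode_mem_C2 (-2 - n).toNat a b
  rwa [show -2 - ((-2 - n).toNat : ℤ) = n by omega] at this

/-- `[a_{-1}, b_{-n}] c ∈ C₂(V)` for `n ≥ 1`. -/
theorem commutator_mem_C2 (a b c : V) {n : ℤ} (hn : n ≤ -1) :
    mode (-1) a (mode n b c) - mode n b (mode (-1) a c) ∈ C2 V := by
  obtain ⟨N, h1, h2, h3⟩ := exists_bound a b c 0 (-1) n
  have h := borcherds_range a b c 0 (-1) n (N + 1) (fun j hj => h1 j (by omega))
    (fun j hj => h2 j (by omega)) (fun j hj => h3 j (by omega))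
  rw [eq_comm, Finset.sum_range_succ' _ N, Finset.sum_eq_zero] at h
  · simp only [Ring.choose_zero_right, zero_add, Nat.cast_zero, pow_zero, Int.negOnePow_zero,
      add_zero, sub_zero, one_smul, mul_one] at h
    rw [h]
    refine Submodule.sum_mem _ fun j _ => ?_
    rw [← Int.cast_smul_eq_zsmul ℂ]
    exact Submodule.smul_mem _ _ (mode_mem_C2' (by omega) _ _)
  · intro j _
    have : Ring.choose (0 : ℤ) (j + 1) = 0 := Ring.choose_zero_pos ℤ (by omega)
    simp [this]

theorem mul_mem_C2_right (a : V) : ∀ x ∈ C2 V, mode (-1) a x ∈ C2 V := by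
  intro x hx
  refine Submodule.span_induction (p := fun x _ => mode (-1) a x ∈ C2 V) ?_ ?_ ?_ ?_ hx
  · rintro _ ⟨b, c, rfl⟩
    have h := commutator_mem_C2 a b c (n := -2) (by norm_num)
    have := Submodule.add_mem _ h (mode_mem_C2' le_rfl b (mode (-1) a c))
    rwa [sub_add_cancel] at this
  · simp
  · intro x y _ _ hx hy; rw [map_add]; exact Submodule.add_mem _ hx hy
  · intro r x _ hx; rw [map_smul]; exact Submodule.smul_mem _ _ hx

/-- `(a_l b)_{-1} c` is `a_{-1} (b_{-1} c)` for `l = -1` and zero for `l = -2`, modulo `C₂(V)`. -/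
theorem iterate_mem_C2 (a b c : V) :
    mode (-1) (mode (-2) a b) c ∈ C2 V ∧
      mode (-1) (mode (-1) a b) c - mode (-1) a (mode (-1) b c) ∈ C2 V := by
  have key : ∀ l : ℤ, ∃ N : ℕ, mode (-1) (mode l a b) c =
      ∑ j ∈ Finset.range N, ((-1) ^ (j + 1) * Ring.choose l (j + 1)) •
        (mode (l - (j + 1)) a (mode (-1 + (j + 1)) b c) -
          l.negOnePow • mode (-1 + l - (j + 1)) b (mode (j + 1) a c)) +
      (mode l a (mode (-1) b c) - l.negOnePow • mode (-1 + l) b (mode 0 a c)) := by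
    intro l
    obtain ⟨N, h1, h2, h3⟩ := exists_bound a b c l 0 (-1)
    have h := borcherds_range a b c l 0 (-1) (N + 1) (fun j hj => h1 j (by omega))
      (fun j hj => h2 j (by omega)) (fun j hj => h3 j (by omega))
    rw [Finset.sum_range_succ' _ N, Finset.sum_eq_zero, Finset.sum_range_succ' _ N] at h
    · refine ⟨N, ?_⟩
      simpa using h
    · intro j _
      have : Ring.choose (0 : ℤ) (j + 1) = 0 := Ring.choose_zero_pos ℤ (by omega)
      simp [this]
  constructor
  · obtain ⟨N, h⟩ := key (-2)
    rw [h]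
    simp only [Units.smul_def, ← Int.cast_smul_eq_zsmul ℂ]
    refine Submodule.add_mem _ (Submodule.sum_mem _ fun j _ => Submodule.smul_mem _ _ ?_) ?_
    all_goals
      exact Submodule.sub_mem _ (mode_mem_C2' (by omega) _ _)
        (Submodule.smul_mem _ _ (mode_mem_C2' (by omega) _ _))
  · obtain ⟨N, h⟩ := key (-1)
    rw [h]
    simp only [Units.smul_def, ← Int.cast_smul_eq_zsmul ℂ]
    rw [add_sub_assoc, sub_sub_cancel_left]
    refine Submodule.add_mem _ (Submodule.sum_mem _ fun j _ => Submodule.smul_mem _ _ ?_)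
      (Submodule.neg_mem _ (Submodule.smul_mem _ _ (mode_mem_C2' (by omega) _ _)))
    exact Submodule.sub_mem _ (mode_mem_C2' (by omega) _ _)
        (Submodule.smul_mem _ _ (mode_mem_C2' (by omega) _ _))

theorem mul_mem_C2_left : ∀ x ∈ C2 V, ∀ c : V, mode (-1) x c ∈ C2 V := by
  intro x hx c
  refine Submodule.span_induction (p := fun x _ => mode (-1) x c ∈ C2 V) ?_ ?_ ?_ ?_ hx
  · rintro _ ⟨a, b, rfl⟩
    exact (iterate_mem_C2 a b c).1
  · simp
  · intro x y _ _ hx hy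
    rw [map_add, LinearMap.add_apply]; exact Submodule.add_mem _ hx hy
  · intro r x _ hx
    rw [map_smul, LinearMap.smul_apply]; exact Submodule.smul_mem _ _ hx

variable (V) in
/-- Zhu's `C₂`-algebra `V / C₂(V)`. -/
def C2Algebra : Type _ := V ⧸ C2 V

noncomputable instance : AddCommGroup (C2Algebra V) := inferInstanceAs (AddCommGroup (V ⧸ C2 V))

noncomputable instance : Module ℂ (C2Algebra V) := inferInstanceAs (Module ℂ (V ⧸ C2 V))

namespace C2Algebra

/-- The class `a + C₂(V)`. -/
def mk : V →ₗ[ℂ] C2Algebra V := (C2 V).mkQ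

theorem mk_surjective : Function.Surjective (mk : V →ₗ[ℂ] C2Algebra V) := (C2 V).mkQ_surjective

theorem mk_eq_mk {a b : V} : (mk a : C2Algebra V) = mk b ↔ a - b ∈ C2 V := Submodule.Quotient.eq _

variable (V) in
/-- The product of `V / C₂(V)`, induced by `a_{-1} b`. -/
noncomputable def mulLin : C2Algebra V →ₗ[ℂ] C2Algebra V →ₗ[ℂ] C2Algebra V :=
  quotMul (C2 V) (mode (-1)) mul_mem_C2_right mul_mem_C2_left

noncomputable instance : Mul (C2Algebra V) := ⟨fun x y => mulLin V x y⟩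

noncomputable instance : One (C2Algebra V) := ⟨mk vac⟩

theorem mul_def (x y : C2Algebra V) : x * y = mulLin V x y := rfl

theorem mk_mul_mk (a b : V) : (mk a * mk b : C2Algebra V) = mk (mode (-1) a b) := rfl

noncomputable instance : CommRing (C2Algebra V) where
  __ := (inferInstance : AddCommGroup (C2Algebra V))
  left_distrib x y z := by simp only [mul_def, map_add]
  right_distrib x y z := by simp only [mul_def, map_add, LinearMap.add_apply]
  zero_mul x := by simp only [mul_def, map_zero, LinearMap.zero_apply]
  mul_zero x := by simp only [mul_def, map_zero]
  mul_assoc x y z := by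
    obtain ⟨a, rfl⟩ := mk_surjective x
    obtain ⟨b, rfl⟩ := mk_surjective y
    obtain ⟨c, rfl⟩ := mk_surjective z
    simp only [mk_mul_mk, mk_eq_mk]
    exact (iterate_mem_C2 a b c).2
  one_mul x := by
    obtain ⟨a, rfl⟩ := mk_surjective x
    change mk (mode (-1) vac a) = mk a
    rw [mode_vac_left, if_pos rfl]
  mul_one x := by
    obtain ⟨a, rfl⟩ := mk_surjective x
    change mk (mode (-1) a vac) = mk a
    rw [mode_vac_right]
  mul_comm x y := by
    obtain ⟨a, rfl⟩ := mk_surjective x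
    obtain ⟨b, rfl⟩ := mk_surjective y
    simp only [mk_mul_mk, mk_eq_mk]
    have h := commutator_mem_C2 a b vac (n := -1) le_rfl
    rwa [mode_vac_right, mode_vac_right] at h

noncomputable instance : Algebra ℂ (C2Algebra V) :=
  Algebra.ofModule (fun r x y => by simp only [mul_def, map_smul, LinearMap.smul_apply])
    (fun r x y => by simp only [mul_def, map_smul])

end C2Algebra

end C2

/-! ### Zhu's algebra -/

section Zhu

/-- `a ∗ b = ∑_j (n choose j) a_{j-1} b`, for `a` of weight `n`. -/
noncomputable def zhuStar (n : ℕ) : V →ₗ[ℂ] V →ₗ[ℂ] V :=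
  ∑ j ∈ Finset.range (n + 1), (n.choose j : ℂ) • mode (j - 1)

/-- `a ∘ b = Res_z Y(a, z) b (1 + z) ^ n / z ^ 2 = ∑_j (n choose j) a_{j-2} b`, for `a` of
weight `n`. -/
noncomputable def zhuCirc (n : ℕ) : V →ₗ[ℂ] V →ₗ[ℂ] V :=
  ∑ j ∈ Finset.range (n + 1), (n.choose j : ℂ) • mode (j - 2)

variable (V) in
/-- `a ∗ b` for all `a`, `b` in `V`, by linearity in `a`. -/
noncomputable def zhuMul : V →ₗ[ℂ] V →ₗ[ℂ] V :=
  DirectSum.toModule ℂ ℕ (V →ₗ[ℂ] V) (fun n => (zhuStar n).domRestrict (wtSpace n)) ∘ₗ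
    (LinearEquiv.ofBijective (DirectSum.coeLinearMap (wtSpace (V := V)))
      isInternal_wtSpace).symm.toLinearMap

variable (V) in
/-- `O(V)`, the span of all `a ∘ b` with `a` homogeneous. -/
def zhuO : Submodule ℂ V :=
  Submodule.span ℂ {x | ∃ n : ℕ, ∃ a ∈ wtSpace (V := V) n, ∃ b : V, x = zhuCirc n a b}

theorem zhuMul_apply {n : ℕ} {a : V} (ha : a ∈ wtSpace n) (b : V) :
    zhuMul V a b = zhuStar n a b := by
  have : (LinearEquiv.ofBijective (DirectSum.coeLinearMap (wtSpace (V := V)))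
      isInternal_wtSpace).symm a = DirectSum.lof ℂ ℕ (fun n => wtSpace (V := V) n) n ⟨a, ha⟩ := by
    rw [LinearEquiv.symm_apply_eq]
    exact (DirectSum.coeLinearMap_lof (wtSpace (V := V)) n ⟨a, ha⟩).symm
  rw [zhuMul, LinearMap.comp_apply, LinearEquiv.coe_coe, this, DirectSum.toModule_lof]
  rfl

open Polynomial in
theorem zhuStar_eq (n : ℕ) (a b : V) : zhuStar n a b = res 1 ((1 + X) ^ n) a b := by
  simp [zhuStar, res_natCast_pow]

open Polynomial in
theorem zhuCirc_eq (n : ℕ) (a b : V) : zhuCirc n a b = res 2 ((1 + X) ^ n) a b := by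
  simp [zhuCirc, res_natCast_pow]

theorem conf_zero_mem {p : ℕ} {a : V} (ha : a ∈ wtSpace p) : mode 0 conf a ∈ wtSpace (p + 1) :=
  mode_mem conf_mem ha (by push_cast; ring)

open Polynomial in
theorem res_mem_zhuO (k p : ℕ) (a b : V) (ha : a ∈ wtSpace p) :
    res (2 + k) ((1 + X) ^ p) a b ∈ zhuO V := by
  induction k generalizing p a with
  | zero =>
    refine Submodule.subset_span ⟨p, a, ha, b, ?_⟩
    rw [zhuCirc_eq]; simp
  | succ k ih =>
    have h := ih (p + 1) _ (conf_zero_mem ha)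
    rw [res_conf] at h
    have hd : derivative ((1 + X) ^ (p + 1) : ℂ[X]) = ((p : ℂ) + 1) • (1 + X) ^ p := by
      rw [derivative_pow_succ, smul_eq_C_mul]; simp
    rw [hd, pow_succ', res_one_add_X_mul, map_smul, LinearMap.smul_apply, LinearMap.smul_apply,
      add_sub_cancel_right] at h
    have h' := Submodule.sub_mem _ h
      (Submodule.smul_mem _ (((2 + k : ℤ) : ℂ) - (p + 1)) (ih p a ha))
    have e : ((2 + k : ℤ) : ℂ) • res (2 + k + 1) ((1 + X) ^ p) a b ∈ zhuO V := by
      convert h' using 1; module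
    rw [Submodule.smul_mem_iff _ (by rw [Int.cast_ne_zero]; omega)] at e
    rwa [Nat.cast_succ, ← add_assoc]

open Polynomial in
theorem res_mem_zhuO' (n p : ℕ) (a b : V) (ha : a ∈ wtSpace p) (m : ℤ) (hm : 2 + n ≤ m) :
    res m ((1 + X) ^ (p + n)) a b ∈ zhuO V := by
  induction n generalizing m with
  | zero =>
    have := res_mem_zhuO (m - 2).toNat p a b ha
    rwa [show 2 + ((m - 2).toNat : ℤ) = m by omega] at this
  | succ n ih =>
    rw [← add_assoc, pow_succ', res_one_add_X_mul]
    exact Submodule.add_mem _ (ih m (by omega)) (ih (m - 1) (by omega))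

open Polynomial in
/-- `∑_k (p choose k) Res_w Y(a_{k-1-e} b, w) c (1 + w) ^ (p + q + e - k) / w`, modulo `O(V)`. -/
theorem iterate_mem_zhuO {p q : ℕ} {a b : V} (ha : a ∈ wtSpace p) (hb : b ∈ wtSpace q) (c : V)
    (e : ℕ) :
    ∑ k ∈ Finset.range (p + 1), (p.choose k : ℂ) •
        res 1 ((1 + X) ^ (p + q + e - k)) (mode (k - (1 + e)) a b) c -
      res (1 + e) ((1 + X) ^ p) a (res 1 ((1 + X) ^ (q + e)) b c) ∈ zhuO V := by
  obtain ⟨N, h1, h2, h3⟩ := exists_bound a b c (-(1 + e)) 0 (-1)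
  have h := borcherds_res a b c (-(1 + e)) 0 (-1) (N + p + 1) (fun j hj => h1 j (by omega))
    (fun j hj => h2 j (by omega)) (fun j hj => h3 j (by omega)) ((1 + X) ^ p)
    ((1 + X) ^ (q + e))
  have hs : ∑ k ∈ Finset.range (p + 1), (p.choose k : ℂ) •
        res 1 ((1 + X) ^ (p + q + e - k)) (mode (k - (1 + e)) a b) c =
      ∑ k ∈ Finset.range (N + p + 1), ∑ rs ∈ Finset.HasAntidiagonal.antidiagonal k,
        ((Ring.choose (0 : ℤ) rs.2 : ℤ) : ℂ) •
          res (rs.2 - 0 - (-1)) (hasseDeriv rs.1 ((1 + X) ^ p) * (1 + X) ^ (q + e))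
            (mode (-(1 + e) + k) a b) c := by
    have hsub : Finset.range (p + 1) ⊆ Finset.range (N + p + 1) :=
      Finset.range_mono (by omega)
    have hk : ∀ k : ℕ, ∑ rs ∈ Finset.HasAntidiagonal.antidiagonal k,
        ((Ring.choose (0 : ℤ) rs.2 : ℤ) : ℂ) •
          res (rs.2 - 0 - (-1)) (hasseDeriv rs.1 ((1 + X) ^ p) * (1 + X) ^ (q + e))
            (mode (-(1 + e) + k) a b) c =
        (p.choose k : ℂ) • res 1 ((1 + X) ^ (p - k + (q + e))) (mode (-(1 + e) + k) a b) c := by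
      intro k
      rw [Finset.sum_eq_single (k, 0)]
      · rw [hasseDeriv_one_add_X_pow, smul_mul_assoc, ← pow_add]
        simp
      · rintro ⟨r, s⟩ hrs hne
        rw [Finset.HasAntidiagonal.mem_antidiagonal] at hrs
        have hs : 0 < s := by
          rcases s with _ | s
          · exact absurd (by simpa using hrs) (fun h : r = k => hne (by rw [h]))
          · omega
        have : Ring.choose (0 : ℤ) s = 0 := Ring.choose_zero_pos ℤ hs
        simp [this]
      · intro hn
        exact absurd (Finset.HasAntidiagonal.mem_antidiagonal.2 (by simp)) hn
    simp only [hk]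
    rw [← Finset.sum_subset hsub]
    · refine Finset.sum_congr rfl fun k hk => ?_
      rw [Finset.mem_range] at hk
      rw [neg_add_eq_sub, show p - k + (q + e) = p + q + e - k by omega]
    · intro k _ hk
      rw [Finset.mem_range, not_lt] at hk
      rw [Nat.choose_eq_zero_of_lt (by omega)]; simp
  rw [hs, h, Finset.sum_range_succ']
  simp only [Units.smul_def, ← Int.cast_smul_eq_zsmul ℂ]
  have e0 : (((-1) ^ 0 * Ring.choose (-(1 + e) : ℤ) 0 : ℤ) : ℂ) = 1 := by simp
  rw [e0, one_smul]
  rw [show ((0 : ℕ) : ℤ) - -(1 + e) - 0 = 1 + e by simp, show -(-1 : ℤ) - (0 : ℕ) = 1 by simp,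
    add_sub_assoc, sub_sub_cancel_left]
  have haO : ∀ (m : ℤ) (x : V), 2 ≤ m → res m ((1 + X) ^ p) a x ∈ zhuO V := fun m x hm => by
    simpa using res_mem_zhuO' 0 p a x ha m (by simpa using hm)
  have hbO : ∀ (m : ℤ) (x : V), 2 + e ≤ m → res m ((1 + X) ^ (q + e)) b x ∈ zhuO V :=
    fun m x hm => res_mem_zhuO' e q b x hb m hm
  refine Submodule.add_mem _ (Submodule.sum_mem _ fun k _ => Submodule.smul_mem _ _ ?_)
    (Submodule.neg_mem _ (Submodule.smul_mem _ _ (hbO _ _ (by push_cast; omega))))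
  exact Submodule.sub_mem _ (haO _ _ (by push_cast; omega))
    (Submodule.smul_mem _ _ (hbO _ _ (by push_cast; omega)))

open Polynomial in
/-- `a ∗ (b ∘ c) - b ∘ (a ∗ c)` is in `O(V)`. -/
theorem commutator_mem_zhuO {p q : ℕ} {a b : V} (ha : a ∈ wtSpace p) (hb : b ∈ wtSpace q) (c : V) :
    res 1 ((1 + X) ^ p) a (res 2 ((1 + X) ^ q) b c) -
      res 2 ((1 + X) ^ q) b (res 1 ((1 + X) ^ p) a c) ∈ zhuO V := by
  obtain ⟨N, h1, h2, h3⟩ := exists_bound a b c 0 (-1) (-2)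
  have h := borcherds_res a b c 0 (-1) (-2) (N + 1) (fun j hj => h1 j (by omega))
    (fun j hj => h2 j (by omega)) (fun j hj => h3 j (by omega)) ((1 + X) ^ p) ((1 + X) ^ q)
  rw [eq_comm, Finset.sum_range_succ' _ N, Finset.sum_eq_zero] at h
  · simp only [Ring.choose_zero_right, zero_add, Nat.cast_zero, pow_zero, Int.negOnePow_zero,
      sub_zero, one_smul, mul_one, Int.cast_one, neg_neg, zero_sub] at h
    rw [h]
    refine Submodule.sum_mem _ fun k _ => Submodule.sum_mem _ fun rs hrs =>
      Submodule.smul_mem _ _ ?_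
    rw [Finset.HasAntidiagonal.mem_antidiagonal] at hrs
    rw [hasseDeriv_one_add_X_pow, smul_mul_assoc, ← pow_add, map_smul, LinearMap.smul_apply,
      LinearMap.smul_apply]
    by_cases hk : k + 1 ≤ p + q
    · by_cases hp : rs.1 ≤ p
      · refine Submodule.smul_mem _ _ ?_
        rw [show p - rs.1 + q = (p + q - k - 1) + (rs.2 + 1) by omega]
        refine res_mem_zhuO' _ _ _ _ (mode_mem ha hb ?_) _ ?_
        · omega
        · push_cast; omega
      · rw [Nat.choose_eq_zero_of_lt (by omega)]; simp
    · rw [mode_eq_zero ha hb (by omega)]; simp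
  · intro j _
    have : Ring.choose (0 : ℤ) (j + 1) = 0 := Ring.choose_zero_pos ℤ (by omega)
    simp [this]

theorem zhuMul_mem_right (a : V) : ∀ x ∈ zhuO V, zhuMul V a x ∈ zhuO V := by
  intro x hx
  refine Submodule.span_induction (p := fun x _ => zhuMul V a x ∈ zhuO V) ?_ ?_ ?_ ?_ hx
  · rintro _ ⟨q, b, hb, c, rfl⟩
    refine wtSpace_induction (P := fun a => zhuMul V a (zhuCirc q b c) ∈ zhuO V) a ?_ ?_ ?_
    · intro p a ha
      rw [zhuMul_apply ha, zhuStar_eq, zhuCirc_eq]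
      have h := Submodule.add_mem _ (commutator_mem_zhuO ha hb c)
        (res_mem_zhuO 0 q b (res 1 ((1 + Polynomial.X) ^ p) a c) hb)
      rwa [Nat.cast_zero, add_zero, sub_add_cancel] at h
    · simp
    · intro x y hx hy
      rw [map_add, LinearMap.add_apply]; exact Submodule.add_mem _ hx hy
  · simp
  · intro x y _ _ hx hy; rw [map_add]; exact Submodule.add_mem _ hx hy
  · intro r x _ hx; rw [map_smul]; exact Submodule.smul_mem _ _ hx

open Polynomial in
theorem zhuMul_sum {p q : ℕ} {a b : V} (ha : a ∈ wtSpace p) (hb : b ∈ wtSpace q) (c : V) (e : ℕ) :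
    zhuMul V (∑ j ∈ Finset.range (p + 1), (p.choose j : ℂ) • mode (j - (1 + e)) a b) c =
      ∑ k ∈ Finset.range (p + 1), (p.choose k : ℂ) •
        res 1 ((1 + X) ^ (p + q + e - k)) (mode (k - (1 + e)) a b) c := by
  rw [map_sum, LinearMap.sum_apply]
  refine Finset.sum_congr rfl fun k hk => ?_
  rw [Finset.mem_range] at hk
  have hm : mode (k - (1 + e)) a b ∈ wtSpace (p + q + e - k) := mode_mem ha hb (by omega)
  rw [map_smul, LinearMap.smul_apply, zhuMul_apply hm, zhuStar_eq]

theorem zhuMul_mem_left : ∀ x ∈ zhuO V, ∀ c, zhuMul V x c ∈ zhuO V := by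
  intro x hx c
  refine Submodule.span_induction (p := fun x _ => zhuMul V x c ∈ zhuO V) ?_ ?_ ?_ ?_ hx
  · rintro _ ⟨p, a, ha, b, rfl⟩
    refine wtSpace_induction (P := fun b => zhuMul V (zhuCirc p a b) c ∈ zhuO V) b ?_ ?_ ?_
    · intro q b hb
      have h := iterate_mem_zhuO ha hb c 1
      rw [← zhuMul_sum ha hb c 1] at h
      have h' := Submodule.add_mem _ h (res_mem_zhuO 0 p a
        (res 1 ((1 + Polynomial.X) ^ (q + 1)) b c) ha)
      rw [Nat.cast_zero, add_zero, Nat.cast_one, one_add_one_eq_two, sub_add_cancel] at h'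
      simpa [zhuCirc] using h'
    · simp
    · intro x y hx hy
      rw [map_add, map_add, LinearMap.add_apply]; exact Submodule.add_mem _ hx hy
  · simp
  · intro x y _ _ hx hy
    rw [map_add, LinearMap.add_apply]; exact Submodule.add_mem _ hx hy
  · intro r x _ hx
    rw [map_smul, LinearMap.smul_apply]; exact Submodule.smul_mem _ _ hx

theorem zhuMul_assoc_mem (a b c : V) :
    zhuMul V (zhuMul V a b) c - zhuMul V a (zhuMul V b c) ∈ zhuO V := by
  refine wtSpace_induction (P := fun a => zhuMul V (zhuMul V a b) c -
    zhuMul V a (zhuMul V b c) ∈ zhuO V) a ?_ (by simp) ?_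
  · intro p a ha
    refine wtSpace_induction (P := fun b => zhuMul V (zhuMul V a b) c -
      zhuMul V a (zhuMul V b c) ∈ zhuO V) b ?_ (by simp) ?_
    · intro q b hb
      have h := iterate_mem_zhuO ha hb c 0
      rw [← zhuMul_sum ha hb c 0] at h
      rw [zhuMul_apply ha, zhuMul_apply ha, zhuMul_apply hb, zhuStar_eq p a (zhuStar q b c),
        zhuStar_eq q b c]
      simpa [zhuStar] using h
    · intro x y hx hy
      have := Submodule.add_mem _ hx hy
      simp only [map_add, LinearMap.add_apply]
      convert this using 1; abel
  · intro x y hx hy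
    have := Submodule.add_mem _ hx hy
    simp only [map_add, LinearMap.add_apply]
    convert this using 1; abel

theorem vac_zhuMul (a : V) : zhuMul V vac a = a := by
  rw [zhuMul_apply vac_mem]
  simp [zhuStar, mode_vac_left]

theorem zhuMul_vac (a : V) : zhuMul V a vac = a := by
  refine wtSpace_induction (P := fun a => zhuMul V a vac = a) a ?_ (by simp) ?_
  · intro n a ha
    rw [zhuMul_apply ha, zhuStar, LinearMap.sum_apply, LinearMap.sum_apply,
      Finset.sum_range_succ', Finset.sum_eq_zero]
    · simp [mode_vac_right]
    · intro j _
      rw [LinearMap.smul_apply, LinearMap.smul_apply, mode_vac_right_nonneg a (by simp), smul_zero]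
  · intro x y hx hy
    rw [map_add, LinearMap.add_apply, hx, hy]

variable (V) in
/-- Zhu's algebra `A(V) = V / O(V)`. -/
def ZhuAlgebra : Type _ := V ⧸ zhuO V

noncomputable instance : AddCommGroup (ZhuAlgebra V) := inferInstanceAs (AddCommGroup (V ⧸ zhuO V))

noncomputable instance : Module ℂ (ZhuAlgebra V) := inferInstanceAs (Module ℂ (V ⧸ zhuO V))

namespace ZhuAlgebra

/-- The class `a + O(V)`. -/
def mk : V →ₗ[ℂ] ZhuAlgebra V := (zhuO V).mkQ

theorem mk_surjective : Function.Surjective (mk : V →ₗ[ℂ] ZhuAlgebra V) :=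
  (zhuO V).mkQ_surjective

theorem mk_eq_mk {a b : V} : (mk a : ZhuAlgebra V) = mk b ↔ a - b ∈ zhuO V :=
  Submodule.Quotient.eq _

variable (V) in
/-- The product of `A(V)`, induced by `a ∗ b`. -/
noncomputable def mulLin : ZhuAlgebra V →ₗ[ℂ] ZhuAlgebra V →ₗ[ℂ] ZhuAlgebra V :=
  quotMul (zhuO V) (zhuMul V) zhuMul_mem_right zhuMul_mem_left

noncomputable instance : Mul (ZhuAlgebra V) := ⟨fun x y => mulLin V x y⟩

noncomputable instance : One (ZhuAlgebra V) := ⟨mk vac⟩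

theorem mul_def (x y : ZhuAlgebra V) : x * y = mulLin V x y := rfl

theorem mk_mul_mk (a b : V) : (mk a * mk b : ZhuAlgebra V) = mk (zhuMul V a b) := rfl

noncomputable instance : Ring (ZhuAlgebra V) where
  __ := (inferInstance : AddCommGroup (ZhuAlgebra V))
  left_distrib x y z := by simp only [mul_def, map_add]
  right_distrib x y z := by simp only [mul_def, map_add, LinearMap.add_apply]
  zero_mul x := by simp only [mul_def, map_zero, LinearMap.zero_apply]
  mul_zero x := by simp only [mul_def, map_zero]
  mul_assoc x y z := by
    obtain ⟨a, rfl⟩ := mk_surjective x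
    obtain ⟨b, rfl⟩ := mk_surjective y
    obtain ⟨c, rfl⟩ := mk_surjective z
    simp only [mk_mul_mk, mk_eq_mk]
    exact zhuMul_assoc_mem a b c
  one_mul x := by
    obtain ⟨a, rfl⟩ := mk_surjective x
    change mk (zhuMul V vac a) = mk a
    rw [vac_zhuMul]
  mul_one x := by
    obtain ⟨a, rfl⟩ := mk_surjective x
    change mk (zhuMul V a vac) = mk a
    rw [zhuMul_vac]

noncomputable instance : Algebra ℂ (ZhuAlgebra V) :=
  Algebra.ofModule (fun r x y => by simp only [mul_def, map_smul, LinearMap.smul_apply])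
    (fun r x y => by simp only [mul_def, map_smul])

end ZhuAlgebra

end Zhu

/-! ### The filtration of `A(V)` and the associated graded algebra -/

section Gr

variable (V) in
/-- `A(V)_n`, the image of `⨁_{i ≤ n} V_i` in `A(V)`. -/
noncomputable def zhuFil (n : ℕ) : Submodule ℂ (ZhuAlgebra V) :=
  (⨆ (i : ℕ) (_ : i ≤ n), wtSpace (V := V) i).map ZhuAlgebra.mk

variable (V) in
/-- `A(V)_{n-1}`, where `A(V)_{-1} = 0`. -/
noncomputable def zhuFilPred : ℕ → Submodule ℂ (ZhuAlgebra V)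
  | 0 => ⊥
  | n + 1 => zhuFil V n

theorem mk_mem_zhuFil {i n : ℕ} (hi : i ≤ n) {a : V} (ha : a ∈ wtSpace i) :
    ZhuAlgebra.mk a ∈ zhuFil V n :=
  Submodule.mem_map_of_mem (le_iSup₂_of_le (f := fun (i : ℕ) (_ : i ≤ n) => wtSpace (V := V) i)
    i hi le_rfl ha)

theorem one_mem_zhuFil : (1 : ZhuAlgebra V) ∈ zhuFil V 0 := mk_mem_zhuFil le_rfl vac_mem

theorem zhuFil_mul_le (m n : ℕ) : zhuFil V m * zhuFil V n ≤ zhuFil V (m + n) := by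
  have h : ∀ n, zhuFil V n = ⨆ (i : ℕ) (_ : i ≤ n), (wtSpace (V := V) i).map ZhuAlgebra.mk := by
    intro n; simp only [zhuFil, Submodule.map_iSup]
  rw [h m, h n]
  simp only [Submodule.iSup_mul, Submodule.mul_iSup, iSup_le_iff]
  intro j hj i hi
  rw [Submodule.mul_le]
  rintro _ ⟨a, ha, rfl⟩ _ ⟨b, hb, rfl⟩
  rw [ZhuAlgebra.mk_mul_mk, zhuMul_apply ha, zhuStar, LinearMap.sum_apply, LinearMap.sum_apply,
    map_sum]
  refine Submodule.sum_mem _ fun k hk => ?_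
  rw [Finset.mem_range] at hk
  rw [LinearMap.smul_apply, LinearMap.smul_apply, map_smul]
  refine Submodule.smul_mem _ _ (mk_mem_zhuFil (i := i + j - k) (by omega) (mode_mem ha hb ?_))
  omega

theorem mul_mem_zhuFil {m n : ℕ} {x y : ZhuAlgebra V} (hx : x ∈ zhuFil V m)
    (hy : y ∈ zhuFil V n) : x * y ∈ zhuFil V (m + n) :=
  zhuFil_mul_le m n (Submodule.mul_mem_mul hx hy)

theorem zhuFil_mono {m n : ℕ} (h : m ≤ n) : zhuFil V m ≤ zhuFil V n :=
  Submodule.map_mono (iSup₂_le fun i hi =>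
    le_iSup₂_of_le (f := fun (i : ℕ) (_ : i ≤ n) => wtSpace (V := V) i) i (hi.trans h) le_rfl)

theorem mul_mem_zhuFilPred_right {m n : ℕ} {x y : ZhuAlgebra V} (hx : x ∈ zhuFil V m)
    (hy : y ∈ zhuFilPred V n) : x * y ∈ zhuFilPred V (m + n) := by
  cases n with
  | zero =>
    rw [(Submodule.mem_bot ℂ).1 hy, mul_zero]; exact Submodule.zero_mem _
  | succ n => exact mul_mem_zhuFil hx hy

theorem mul_mem_zhuFilPred_left {m n : ℕ} {x y : ZhuAlgebra V} (hx : x ∈ zhuFilPred V m)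
    (hy : y ∈ zhuFil V n) : x * y ∈ zhuFilPred V (m + n) := by
  cases m with
  | zero =>
    rw [(Submodule.mem_bot ℂ).1 hx, zero_mul]; exact Submodule.zero_mem _
  | succ m =>
    rw [show m + 1 + n = m + n + 1 by omega]
    exact mul_mem_zhuFil (m := m) hx hy

variable (V) in
/-- The homogeneous piece `A(V)_n / A(V)_{n-1}` of `gr A(V)`. -/
def GrPiece (n : ℕ) : Type _ := zhuFil V n ⧸ (zhuFilPred V n).submoduleOf (zhuFil V n)

noncomputable instance (n : ℕ) : AddCommGroup (GrPiece V n) :=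
  inferInstanceAs (AddCommGroup (zhuFil V n ⧸ (zhuFilPred V n).submoduleOf (zhuFil V n)))

noncomputable instance (n : ℕ) : Module ℂ (GrPiece V n) :=
  inferInstanceAs (Module ℂ (zhuFil V n ⧸ (zhuFilPred V n).submoduleOf (zhuFil V n)))

namespace GrPiece

/-- The class in `A(V)_n / A(V)_{n-1}` of an element of `A(V)_n`. -/
noncomputable def mk (n : ℕ) : zhuFil V n →ₗ[ℂ] GrPiece V n :=
  ((zhuFilPred V n).submoduleOf (zhuFil V n)).mkQ

theorem mk_surjective (n : ℕ) : Function.Surjective (mk (V := V) n) :=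
  Submodule.mkQ_surjective _

/-- The product `x̄ · ȳ = \overline{x y}` of the pieces of `gr A(V)`. -/
noncomputable def mulLin (m n : ℕ) : GrPiece V m →ₗ[ℂ] GrPiece V n →ₗ[ℂ] GrPiece V (m + n) :=
  Submodule.liftQ _
    { toFun := fun x => Submodule.mapQ _ ((zhuFilPred V (m + n)).submoduleOf (zhuFil V (m + n)))
        (((LinearMap.mul ℂ (ZhuAlgebra V) x.1).restrict
          fun y (hy : y ∈ zhuFil V n) => mul_mem_zhuFil x.2 hy))
        (fun y hy => mul_mem_zhuFilPred_right x.2 hy)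
      map_add' := fun x y => by
        refine Submodule.linearMap_qext _ (LinearMap.ext fun z => ?_)
        exact congrArg (mk (m + n)) (Subtype.ext (add_mul x.1 y.1 z.1))
      map_smul' := fun r x => by
        refine Submodule.linearMap_qext _ (LinearMap.ext fun z => ?_)
        exact congrArg (mk (m + n)) (Subtype.ext (smul_mul_assoc r x.1 z.1)) }
    (fun x hx => by
      rw [LinearMap.mem_ker]
      refine Submodule.linearMap_qext _ (LinearMap.ext fun y => ?_)
      exact (Submodule.Quotient.mk_eq_zero _).2 (mul_mem_zhuFilPred_left hx y.2))

theorem mulLin_mk (m n : ℕ) (x : zhuFil V m) (y : zhuFil V n) :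
    mulLin m n (mk m x) (mk n y) = mk (m + n) ⟨x.1 * y.1, mul_mem_zhuFil x.2 y.2⟩ := rfl

theorem gradedMonoid_ext {m n : ℕ} (h : m = n) (x : zhuFil V m) (y : zhuFil V n)
    (hxy : x.1 = y.1) :
    (GradedMonoid.mk m (mk m x) : GradedMonoid (GrPiece V)) = GradedMonoid.mk n (mk n y) := by
  subst h
  rw [Subtype.ext hxy]

noncomputable instance : GradedMonoid.GMul (GrPiece V) := ⟨fun {m n} x y => mulLin m n x y⟩

noncomputable instance : GradedMonoid.GOne (GrPiece V) := ⟨mk 0 ⟨1, one_mem_zhuFil⟩⟩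

noncomputable instance : GradedMonoid.GMonoid (GrPiece V) where
  one_mul := by
    rintro ⟨n, x⟩
    obtain ⟨x, rfl⟩ := mk_surjective n x
    exact gradedMonoid_ext (zero_add n) _ _ (one_mul x.1)
  mul_one := by
    rintro ⟨n, x⟩
    obtain ⟨x, rfl⟩ := mk_surjective n x
    exact gradedMonoid_ext (add_zero n) _ _ (mul_one x.1)
  mul_assoc := by
    rintro ⟨l, x⟩ ⟨m, y⟩ ⟨n, z⟩
    obtain ⟨x, rfl⟩ := mk_surjective l x
    obtain ⟨y, rfl⟩ := mk_surjective m y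
    obtain ⟨z, rfl⟩ := mk_surjective n z
    exact gradedMonoid_ext (add_assoc l m n) _ _ (mul_assoc x.1 y.1 z.1)

noncomputable instance : DirectSum.GRing (GrPiece V) where
  mul_zero x := map_zero (mulLin _ _ x)
  zero_mul y := by
    change mulLin _ _ 0 y = 0
    rw [map_zero, LinearMap.zero_apply]
  mul_add x y z := map_add (mulLin _ _ x) y z
  add_mul x y z := by
    change mulLin _ _ (x + y) z = mulLin _ _ x z + mulLin _ _ y z
    rw [map_add, LinearMap.add_apply]
  natCast n := n • GradedMonoid.GOne.one
  natCast_zero := zero_smul _ _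
  natCast_succ n := succ_nsmul _ _
  intCast n := n • GradedMonoid.GOne.one
  intCast_ofNat n := natCast_zsmul _ _
  intCast_negSucc_ofNat n := negSucc_zsmul _ _

noncomputable instance : DirectSum.GAlgebra ℂ (GrPiece V) where
  toFun := (LinearMap.toSpanSingleton ℂ (GrPiece V 0) GradedMonoid.GOne.one).toAddMonoidHom
  map_one := one_smul ℂ (GradedMonoid.GOne.one : GrPiece V 0)
  map_mul r s := gradedMonoid_ext (V := V) (m := 0) (n := 0) rfl
    ((r * s) • ⟨1, one_mem_zhuFil⟩) ⟨(r • 1) * (s • 1), mul_mem_zhuFil (m := 0) (n := 0)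
      (Submodule.smul_mem _ _ one_mem_zhuFil) (Submodule.smul_mem _ _ one_mem_zhuFil)⟩
    (by simp [smul_smul, mul_comm])
  commutes := by
    rintro r ⟨n, x⟩
    obtain ⟨x, rfl⟩ := mk_surjective n x
    exact gradedMonoid_ext (by omega)
      ⟨(r • 1) * x.1, mul_mem_zhuFil (Submodule.smul_mem _ _ one_mem_zhuFil) x.2⟩
      ⟨x.1 * (r • 1), mul_mem_zhuFil x.2 (Submodule.smul_mem _ _ one_mem_zhuFil)⟩ (by simp)
  smul_def := by
    rintro r ⟨n, x⟩
    obtain ⟨x, rfl⟩ := mk_surjective n x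
    exact gradedMonoid_ext (by omega) (r • x)
      ⟨(r • 1) * x.1, mul_mem_zhuFil (Submodule.smul_mem _ _ one_mem_zhuFil) x.2⟩ (by simp)

end GrPiece

variable (V) in
/-- The associated graded algebra `gr A(V) = ⨁_n A(V)_n / A(V)_{n-1}`. -/
abbrev GrZhu : Type _ := ⨁ n, GrPiece V n

/-- For `x ∈ V_n`, the class `x̄ ∈ A(V)_n / A(V)_{n-1} ⊆ gr A(V)`. -/
noncomputable def grClass (n : ℕ) (x : wtSpace (V := V) n) : GrZhu V :=
  DirectSum.of (GrPiece V) n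
    (GrPiece.mk n ⟨ZhuAlgebra.mk (x : V), mk_mem_zhuFil le_rfl x.2⟩)

end Gr

end VertexOperatorAlgebra

open VertexOperatorAlgebra

namespace VertexOperatorAlgebra

open scoped DirectSum

variable {V : Type*} [AddCommGroup V] [Module ℂ V] [VertexOperatorAlgebra V]

/-! Everything comes from counting weights. For `a` of weight `p` and `b` of weight `q`, the vector
`a_{j-d} b` has weight `p + q + d - 1 - j`. In a sum `∑_j (p choose j) a_{j-d} b` the term `j = 0`
therefore has the top weight `p + q + d - 1`, and every other term falls into a strictly lower step
of the filtration of `A(V)`. This is `mk_sum_sub_mem_zhuFilPred`, and it is used for two values of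
`d`.

For `d = 1` the sum is `a ∗ b`, so `a ∗ b` and `a_{-1} b` have the same class in degree `p + q`
(`grClass_mul_grClass`). For `d = 2` the sum is `a ∘ b`, which is zero in `A(V)`; hence the image of
`a_{-2} b`, a vector of weight `p + q + 1`, already lies in `A(V)_{p+q}`, and its class in degree `p
+ q + 1` vanishes (`grLin_mode_neg_two`).

Consequently the linear map `V → gr A(V)` sending homogeneous `x` to its class kills `C₂(V)` and
turns `a_{-1} b` into a product, so it descends to an algebra homomorphism on `V / C₂(V)`. It is
surjective because `A(V)_n` is spanned by the images of the `V_i` with `i ≤ n`, and those with `i <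
n` vanish in `A(V)_n / A(V)_{n-1}`. Commutativity of `gr A(V)` needs no comparison of `a ∗ b` with
`b ∗ a`: it is inherited from `V / C₂(V)` through the surjection. -/

theorem mk_mem_zhuFilPred {i n : ℕ} (hi : i < n) {a : V} (ha : a ∈ wtSpace i) :
    ZhuAlgebra.mk a ∈ zhuFilPred V n := by
  cases n with
  | zero => omega
  | succ n => exact mk_mem_zhuFil (by omega) ha

theorem GrPiece.mk_eq_mk {n : ℕ} {x y : zhuFil V n} :
    GrPiece.mk n x = GrPiece.mk n y ↔ (x : ZhuAlgebra V) - y ∈ zhuFilPred V n :=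
  Submodule.Quotient.eq _

theorem GrPiece.mk_eq_zero {n : ℕ} {x : zhuFil V n} :
    GrPiece.mk n x = 0 ↔ (x : ZhuAlgebra V) ∈ zhuFilPred V n :=
  Submodule.Quotient.mk_eq_zero _

/-- The terms of positive index of `∑_j (p choose j) a_{j-d} b` lie in lower filtration degree. -/
theorem mk_sum_sub_mem_zhuFilPred {p q d : ℕ} {a b : V} (ha : a ∈ wtSpace p)
    (hb : b ∈ wtSpace q) (hd : 1 ≤ d) :
    ZhuAlgebra.mk (∑ j ∈ Finset.range (p + 1), (p.choose j : ℂ) • mode (j - d) a b) -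
      ZhuAlgebra.mk (mode (-d) a b) ∈ zhuFilPred V (p + q + d - 1) := by
  -- Splitting off `j = 0` cancels the subtracted leading term; the remaining terms are reindexed,
  -- with `j + 1` in place of `j`.
  rw [Finset.sum_range_succ', map_add]
  simp only [Nat.choose_zero_right, Nat.cast_one, one_smul, Nat.cast_zero, zero_sub,
    add_sub_cancel_right, map_sum, map_smul]
  refine Submodule.sum_mem _ fun j hj => Submodule.smul_mem _ _ ?_
  rw [Finset.mem_range] at hj
  -- The weight of `a_{j+1-d} b`. Since `j < p` and `1 ≤ d`, the subtractions in `ℕ` are not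
  -- truncated and the weight is strictly below `p + q + d - 1`. For `p = 0` there is no such term,
  -- so the degree-zero case, where the lower step is `⊥`, causes no trouble.
  exact mk_mem_zhuFilPred (i := p + q + d - 1 - (j + 1)) (by omega)
    (mode_mem ha hb (by omega))

/-- The case `d = 1` of the leading-term estimate: passing to `gr A(V)` discards all of `a ∗ b`
except its term of top weight. -/
theorem grClass_mul_grClass (m n : ℕ) (a : wtSpace (V := V) m) (b : wtSpace (V := V) n) :
    grClass m a * grClass n b =
      grClass (m + n) ⟨mode (-1) (a : V) (b : V), mode_neg_one_mem a.2 b.2⟩ := by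
  rw [grClass, grClass, grClass, DirectSum.of_mul_of]
  congr 1
  refine GrPiece.mk_eq_mk.2 ?_
  have h := mk_sum_sub_mem_zhuFilPred (d := 1) a.2 b.2 le_rfl
  -- The products of `gr A(V)` and of `A(V)` are both induced on quotients, so the left factor
  -- unfolds by definition to the class of `a ∗ b`.
  change ZhuAlgebra.mk (zhuMul V a b) - ZhuAlgebra.mk (mode (-1) (a : V) (b : V)) ∈ _
  rw [zhuMul_apply a.2]
  simpa [zhuStar] using h

/-! ### The linear map from `V` to `gr A(V)` -/

variable (V) in
/-- The linear map `V → gr A(V)` given by `x ↦ x̄` on homogeneous elements. -/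
noncomputable def grLin : V →ₗ[ℂ] GrZhu V :=
  DirectSum.toModule ℂ ℕ (GrZhu V) (fun n =>
      DirectSum.lof ℂ ℕ (GrPiece V) n ∘ₗ GrPiece.mk n ∘ₗ
        (ZhuAlgebra.mk.restrict fun _ hx => mk_mem_zhuFil le_rfl hx)) ∘ₗ
    (LinearEquiv.ofBijective (DirectSum.coeLinearMap (wtSpace (V := V)))
      isInternal_wtSpace).symm.toLinearMap

theorem grLin_apply {n : ℕ} {x : V} (hx : x ∈ wtSpace n) : grLin V x = grClass n ⟨x, hx⟩ := by
  have : (LinearEquiv.ofBijective (DirectSum.coeLinearMap (wtSpace (V := V)))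
      isInternal_wtSpace).symm x = DirectSum.lof ℂ ℕ (fun n => wtSpace (V := V) n) n ⟨x, hx⟩ := by
    rw [LinearEquiv.symm_apply_eq]
    exact (DirectSum.coeLinearMap_lof (wtSpace (V := V)) n ⟨x, hx⟩).symm
  rw [grLin, LinearMap.comp_apply, LinearEquiv.coe_coe, this, DirectSum.toModule_lof]
  rfl

/-- Both sides are bilinear in `a` and `b`, so it suffices to treat homogeneous vectors, where this
is `grClass_mul_grClass`. -/
theorem grLin_mode_neg_one (a b : V) : grLin V (mode (-1) a b) = grLin V a * grLin V b := by
  refine wtSpace_induction (P := fun a => grLin V (mode (-1) a b) = grLin V a * grLin V b) a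
    ?_ (by simp) fun x y hx hy => by simp only [map_add, LinearMap.add_apply, hx, hy, add_mul]
  intro m a ha
  refine wtSpace_induction (P := fun b => grLin V (mode (-1) a b) = grLin V a * grLin V b) b
    ?_ (by simp) fun x y hx hy => by simp only [map_add, hx, hy, mul_add]
  intro n b hb
  rw [grLin_apply ha, grLin_apply hb, grClass_mul_grClass, grLin_apply (mode_neg_one_mem ha hb)]

/-- The relation `a ∘ b = 0` in `A(V)` mixes weights. Solved for its top term, it writes the image
of `a_{-2} b` through vectors of lower weight, so nothing survives in the associated graded. -/
theorem grLin_mode_neg_two (a b : V) : grLin V (mode (-2) a b) = 0 := by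
  refine wtSpace_induction (P := fun a => grLin V (mode (-2) a b) = 0) a
    ?_ (by simp) fun x y hx hy => by simp only [map_add, LinearMap.add_apply, hx, hy, add_zero]
  intro p a ha
  refine wtSpace_induction (P := fun b => grLin V (mode (-2) a b) = 0) b
    ?_ (by simp) fun x y hx hy => by simp only [map_add, hx, hy, add_zero]
  intro q b hb
  have hm : mode (-2) a b ∈ wtSpace (p + q + 1) := mode_mem ha hb (by push_cast; ring)
  have h := mk_sum_sub_mem_zhuFilPred (d := 2) ha hb (by norm_num)
  -- The sum in the estimate `h` for `d = 2` is `a ∘ b`, one of the generators of `O(V)`. With it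
  -- gone, `h` says that the image of `a_{-2} b` lies in `A(V)_{p+q}`, one step below its weight `p
  -- + q + 1`.
  have h0 : ZhuAlgebra.mk (∑ j ∈ Finset.range (p + 1), (p.choose j : ℂ) •
      mode (j - (2 : ℕ)) a b) = 0 := by
    refine (Submodule.Quotient.mk_eq_zero (zhuO V)).2
      (Submodule.subset_span ⟨p, a, ha, b, ?_⟩)
    simp [zhuCirc]
  rw [h0, zero_sub, Submodule.neg_mem_iff] at h
  rw [grLin_apply hm, grClass, GrPiece.mk_eq_zero.2 h, map_zero]

theorem C2_le_ker_grLin : C2 V ≤ LinearMap.ker (grLin V) := by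
  refine Submodule.span_le.2 ?_
  rintro _ ⟨a, b, rfl⟩
  exact grLin_mode_neg_two a b

/-! ### Surjectivity and the induced algebra homomorphism -/

theorem grLin_surjective : Function.Surjective (grLin V) := by
  rw [← LinearMap.range_eq_top, eq_top_iff]
  rintro s -
  induction s using DirectSum.induction_on with
  | zero => exact Submodule.zero_mem _
  | add s t hs ht => exact Submodule.add_mem _ hs ht
  | of n s =>
    obtain ⟨⟨x, hx⟩, rfl⟩ := GrPiece.mk_surjective n s
    -- The elements of `A(V)_n` whose class lies in the range form a subspace. Pushed forward into
    -- `A(V)`, it can be compared with `zhuFil V n` on the generating subspaces `V_i`, `i ≤ n`.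
    have hle : zhuFil V n ≤ ((LinearMap.range (grLin V)).comap
        (DirectSum.lof ℂ ℕ (GrPiece V) n ∘ₗ GrPiece.mk n)).map (zhuFil V n).subtype := by
      refine Submodule.map_le_iff_le_comap.2 (iSup₂_le fun i hi a ha => ?_)
      refine ⟨⟨ZhuAlgebra.mk a, mk_mem_zhuFil hi ha⟩, ?_, rfl⟩
      -- In top weight `i = n` the class is the image of `a` itself; for `i < n` it is zero, hence
      -- the image of `0`.
      rcases hi.eq_or_lt with rfl | hi
      · exact ⟨a, grLin_apply ha⟩
      · refine ⟨0, ?_⟩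
        rw [LinearMap.comp_apply, GrPiece.mk_eq_zero.2 (mk_mem_zhuFilPred hi ha), map_zero,
          map_zero]
    obtain ⟨⟨y, hy⟩, hy', rfl⟩ := hle hx
    exact hy'

variable (V) in
/-- The homomorphism `V / C₂(V) → gr A(V)`, `x + C₂(V) ↦ x̄`. -/
noncomputable def C2Algebra.toGrZhu : C2Algebra V →ₐ[ℂ] GrZhu V :=
  -- The unit is preserved because the unit of `gr A(V)` is by definition the class of the vacuum in
  -- degree `0`.
  AlgHom.ofLinearMap ((C2 V).liftQ (grLin V) C2_le_ker_grLin) (grLin_apply vac_mem) fun x y => by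
    obtain ⟨a, rfl⟩ := C2Algebra.mk_surjective x
    obtain ⟨b, rfl⟩ := C2Algebra.mk_surjective y
    exact grLin_mode_neg_one a b

theorem C2Algebra.toGrZhu_mk (a : V) : C2Algebra.toGrZhu V (C2Algebra.mk a) = grLin V a := rfl

theorem C2Algebra.toGrZhu_surjective : Function.Surjective (C2Algebra.toGrZhu V) := fun s => by
  obtain ⟨a, rfl⟩ := grLin_surjective s
  exact ⟨C2Algebra.mk a, C2Algebra.toGrZhu_mk a⟩

end VertexOperatorAlgebra

theorem proposition3p3 {V : Type*} [AddCommGroup V] [Module ℂ V] [VertexOperatorAlgebra V] :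
    (∀ s t : GrZhu V, s * t = t * s) ∧
    (∀ (m n : ℕ) (a : wtSpace (V := V) m) (b : wtSpace (V := V) n),
      grClass m a * grClass n b =
        grClass (m + n) ⟨mode (-1) (a : V) (b : V), mode_neg_one_mem a.2 b.2⟩) ∧
    ∃ φ : C2Algebra V →ₐ[ℂ] GrZhu V,
      Function.Surjective φ ∧
      ∀ (n : ℕ) (x : wtSpace (V := V) n), φ (C2Algebra.mk (x : V)) = grClass n x := by
  refine ⟨fun s t => ?_, grClass_mul_grClass, C2Algebra.toGrZhu V, C2Algebra.toGrZhu_surjective,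
    fun n x => grLin_apply x.2⟩
  -- Commutativity is pulled back along the surjection to the commutative ring `V / C₂(V)`.
  obtain ⟨x, rfl⟩ := C2Algebra.toGrZhu_surjective s
  obtain ⟨y, rfl⟩ := C2Algebra.toGrZhu_surjective t
  rw [← map_mul, mul_comm, map_mul]
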